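/- Let $(q_k)_{k\ge 1}$ be a sequence of positive integers with $q_{k+1}\ge q_k(q_k+1)$ for all $k$ (a second Ostrogradsky sequence). Let $\xi_1,\xi_2,\dots$ be independent random variables taking the values $0$ and $1$ with probabilities $p_{0k}$ and $p_{1k}$ respectively ($p_{0k}+p_{1k}=1$), and let $\mu_\xi$ be the distribution of $$\xi=\sum_{k=1}^\infty \frac{(-1)^{k+1}\xi_k}{q_k}.$$ Assume that $\max\{p_{0k},p_{1k}\}<1$ for infinitely many $k$. For $i\in\{0,1\}$ put $p^*_{ik}=p_{ik}$ if $p_{ik}\in\{0,1\}$ and $p^*_{ik}=\tfrac12$ otherwise, and let $\nu^*$ (the uniform distribution on the spectrum of $\mu_\xi$) be the distribution of $\xi^*=\sum_{k=1}^\infty (-1)^{k+1}\xi^*_k/q_k$, where $\xi^*_1,\xi^*_2,\dots$ are independent and take the values $0$ and $1$ with probabilities $p^*_{0k}$ and $p^*_{1k}$. For a set $E\subset\mathbb R$, a probability measure $\nu$ on $\mathbb R$ without atoms and $\alpha>0$, let $$H^\alpha(E,\nu)=\lim_{\varepsilon\to0}\ \inf\Big\{\sum_j \nu(E_j)^\alpha\Big\},$$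 where the infimum is over all at most countable coverings of $E$ by bounded closed intervals $E_j$ with $\nu(E_j)\le\varepsilon$. Let $\dim_H(E,\nu)=\inf\{\alpha>0: H^\alpha(E,\nu)=0\}$, and define the Hausdorff--Billingsley dimension of a probability measure $\mu$ with respect to $\nu$ by $$\dim_H(\mu,\nu)=\inf\{\dim_H(E,\nu): E \text{ Borel},\ \mu(E)=1\}.$$ Let $h_n=-(p_{0n}\ln p_{0n}+p_{1n}\ln p_{1n})$ (with $0\ln 0=0$) be the entropy of $\xi_n$, let $H_n=h_1+\dots+h_n$, and let $g_n$ be the number of positive elements among $h_1,\dots,h_n$. Then $$\dim_H(\mu_\xi,\nu^*)=\liminf_{n\to\infty}\frac{H_n}{g_n\ln 2}.$$ -/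

import Mathlib

open MeasureTheory ProbabilityTheory Filter
open scoped ENNReal NNReal

noncomputable section

namespace Ostrogradsky

/-! ### Hausdorff-Billingsley measures and dimensions -/

/-- The `ν`-`α`-Hausdorff-Billingsley measure of `E` with respect to the family `Φ` of covering
sets: the limit as `ε → 0` (that is, the supremum over `ε > 0`, the expression being monotone in
`ε`) of the infimum of `∑ j, ν (E j) ^ α` over all at most countable coverings of `E` by members
of `Φ` whose `ν`-measures are at most `ε`. -/
def hbMeasure (α : ℝ≥0) (E : Set ℝ) (ν : Measure ℝ) (Φ : Set (Set ℝ)) : ℝ≥0∞ :=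
  ⨆ (ε : ℝ≥0∞) (_ : 0 < ε),
    ⨅ (𝒞 : Set (Set ℝ)) (_ : 𝒞 ⊆ Φ) (_ : 𝒞.Countable) (_ : E ⊆ ⋃₀ 𝒞) (_ : ∀ I ∈ 𝒞, ν I ≤ ε),
      ∑' I : 𝒞, ν (I : Set ℝ) ^ (α : ℝ)

/-- The Hausdorff-Billingsley dimension of `E` with respect to `ν` and the family `Φ`:
the infimum of all `α > 0` with vanishing `ν`-`α`-Hausdorff-Billingsley measure. -/
def hbDimFamily (E : Set ℝ) (ν : Measure ℝ) (Φ : Set (Set ℝ)) : ℝ≥0∞ :=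
  ⨅ (α : ℝ≥0) (_ : 0 < α) (_ : hbMeasure α E ν Φ = 0), (α : ℝ≥0∞)

/-- The family of all bounded closed intervals of the real line. -/
def closedIntervals : Set (Set ℝ) :=
  {I | ∃ c d : ℝ, c ≤ d ∧ I = Set.Icc c d}

/-- The family of all closed subintervals of the smallest closed interval containing the
(bounded) set `M`. -/
def closedSubintervals (M : Set ℝ) : Set (Set ℝ) :=
  {I | ∃ c d : ℝ, sInf M ≤ c ∧ c ≤ d ∧ d ≤ sSup M ∧ I = Set.Icc c d}

/-- The classical Hausdorff-Billingsley dimension of `E` with respect to `ν`: coverings by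
closed intervals. By `hbDimFamily_closedSubintervals` below, for a bounded set `M` containing `E`
nothing changes if only closed subintervals of the smallest closed interval containing `M` are
admitted. -/
def hbDim (E : Set ℝ) (ν : Measure ℝ) : ℝ≥0∞ :=
  hbDimFamily E ν closedIntervals

theorem hbMeasure_closedSubintervals (α : ℝ≥0) {E M : Set ℝ} (hM : Bornology.IsBounded M)
    (hE : E ⊆ M) (ν : Measure ℝ) :
    hbMeasure α E ν (closedSubintervals M) = hbMeasure α E ν closedIntervals := by
  refine le_antisymm (iSup₂_mono fun ε _ => ?_) (iSup₂_mono fun ε _ => ?_)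
  · refine le_iInf fun 𝒞 => le_iInf fun h1 => le_iInf fun h2 => le_iInf fun h3 =>
      le_iInf fun h4 => ?_
    let f : Set ℝ → Set ℝ := fun I => I ∩ Set.Icc (sInf M) (sSup M)
    let 𝒟 : Set (Set ℝ) := f '' {I ∈ 𝒞 | (f I).Nonempty}
    have hD : ∀ J : 𝒟, ∃ I : 𝒞, f I = J := by
      rintro ⟨_, I, ⟨hI, -⟩, rfl⟩
      exact ⟨⟨I, hI⟩, rfl⟩
    choose g hg using hD
    have hginj : Function.Injective g := by
      intro J K hJK
      apply Subtype.ext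
      rw [← hg J, ← hg K, hJK]
    have hle : ∀ J : 𝒟, ν (J : Set ℝ) ≤ ν (g J : Set ℝ) := by
      intro J
      rw [← hg J]
      exact measure_mono Set.inter_subset_left
    refine iInf_le_of_le 𝒟 (iInf_le_of_le ?_ (iInf_le_of_le ?_ (iInf_le_of_le ?_
      (iInf_le_of_le ?_ ?_))))
    · rintro _ ⟨I, ⟨hI, hne⟩, rfl⟩
      obtain ⟨c, d, -, rfl⟩ := h1 hI
      have hf : f (Set.Icc c d) = Set.Icc (max c (sInf M)) (min d (sSup M)) := Set.Icc_inter_Icc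
      rw [hf] at hne ⊢
      exact ⟨_, _, le_max_right _ _, Set.nonempty_Icc.1 hne, min_le_right _ _, rfl⟩
    · exact (h2.mono (Set.sep_subset _ _)).image f
    · intro x hx
      obtain ⟨I, hI, hxI⟩ := h3 hx
      have hxf : x ∈ f I := ⟨hxI, csInf_le hM.bddBelow (hE hx), le_csSup hM.bddAbove (hE hx)⟩
      exact ⟨f I, ⟨I, ⟨hI, ⟨x, hxf⟩⟩, rfl⟩, hxf⟩
    · intro J hJ
      exact (hle ⟨J, hJ⟩).trans (h4 _ (g ⟨J, hJ⟩).2)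
    · calc ∑' J : 𝒟, ν (J : Set ℝ) ^ (α : ℝ)
          ≤ ∑' J : 𝒟, ν (g J : Set ℝ) ^ (α : ℝ) :=
            ENNReal.tsum_le_tsum fun J => ENNReal.rpow_le_rpow (hle J) α.2
        _ ≤ ∑' I : 𝒞, ν (I : Set ℝ) ^ (α : ℝ) :=
            ENNReal.tsum_comp_le_tsum_of_injective hginj
              (fun I : 𝒞 => ν (I : Set ℝ) ^ (α : ℝ))
  · refine iInf_mono fun 𝒞 => iInf_mono' fun h1 => ⟨?_, le_rfl⟩
    intro I hI
    obtain ⟨c, d, -, hcd, -, rfl⟩ := h1 hI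
    exact ⟨c, d, hcd, rfl⟩

theorem hbDimFamily_closedSubintervals {E M : Set ℝ} (hM : Bornology.IsBounded M)
    (hE : E ⊆ M) (ν : Measure ℝ) :
    hbDimFamily E ν (closedSubintervals M) = hbDim E ν := by
  simp only [hbDim, hbDimFamily, hbMeasure_closedSubintervals _ hM hE]

/-- The Hausdorff-Billingsley dimension of the measure `μ` with respect to the measure `ν`: the
infimum of the dimensions of all Borel sets of full `μ`-measure. -/
def hbDimMeasure (μ ν : Measure ℝ) : ℝ≥0∞ :=
  ⨅ (E : Set ℝ) (_ : MeasurableSet E) (_ : μ E = 1), hbDim E ν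

/-! ### Random incomplete sums of second Ostrogradsky series

All sequences are indexed from `0`, so that the `k`-th term (`k ≥ 1`) in the usual numbering has
index `k - 1` here; in particular the sign `(-1) ^ (k + 1)` becomes `(-1) ^ k`. -/

/-- A second Ostrogradsky sequence: positive integers with `q (k + 1) ≥ q k * (q k + 1)`. -/
def IsSecondOstrogradsky (q : ℕ → ℕ) : Prop :=
  ∀ k, 0 < q k ∧ q k * (q k + 1) ≤ q (k + 1)

/-- `ξ` is a sequence of independent random variables on `(Ω, P)`, the `k`-th of which takes
the values `i = 0` and `i = 1` with probabilities `p i k`, where `p 0 k + p 1 k = 1`. -/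
structure IsBernoulliSequence {Ω : Type*} [MeasurableSpace Ω] (P : Measure Ω)
    (ξ : ℕ → Ω → ℝ) (p : Fin 2 → ℕ → ℝ) : Prop where
  measurable : ∀ k, Measurable (ξ k)
  indep : iIndepFun ξ P
  prob_zero : ∀ k, P.real {ω | ξ k ω = 0} = p 0 k
  prob_one : ∀ k, P.real {ω | ξ k ω = 1} = p 1 k
  sum_eq_one : ∀ k, p 0 k + p 1 k = 1

/-- The distribution of the random variable `∑ k, (-1) ^ k * ξ k / q k`. -/
def seriesLaw {Ω : Type*} [MeasurableSpace Ω] (P : Measure Ω) (ξ : ℕ → Ω → ℝ) (q : ℕ → ℕ) :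
    Measure ℝ :=
  P.map fun ω => ∑' k, (-1 : ℝ) ^ k * ξ k ω / (q k : ℝ)

/-- The probabilities of the digits under the uniform distribution on the spectrum: `0` and `1`
are kept, and every value strictly between them is replaced by `1 / 2`. -/
def uniformProb (p : Fin 2 → ℕ → ℝ) (i : Fin 2) (k : ℕ) : ℝ :=
  if p i k = 0 then 0 else if p i k = 1 then 1 else 1 / 2

/-- The entropy of the `k`-th digit; `0 * log 0 = 0`. -/
def entropy (p : Fin 2 → ℕ → ℝ) (k : ℕ) : ℝ :=
  -(p 0 k * Real.log (p 0 k) + p 1 k * Real.log (p 1 k))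

/-- The sum of the entropies of the first `n` digits. -/
def entropySum (p : Fin 2 → ℕ → ℝ) (n : ℕ) : ℝ :=
  ∑ k ∈ Finset.range n, entropy p k

open Classical in
/-- The number of the first `n` digits whose entropy is positive. -/
def positiveCount (p : Fin 2 → ℕ → ℝ) (n : ℕ) : ℕ :=
  ((Finset.range n).filter fun k => 0 < entropy p k).card

end Ostrogradsky

end

namespace Ostrogradsky

/-! ### Probabilities of words and their exponential moments -/

/-! The growth of `q` makes the sum an injective continuous function of the digits, ordered by the
first differing digit up to a sign depending on its position. Hence each cylinder of digit sequences
is exactly the preimage of a closed interval (`exists_hull`), and everything can be computed on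
digit space, where cylinder masses are products. Every cylinder of level `n` charged by `μ_ξ` has
`ν*`-mass exactly `2 ^ (-g_n)`, so the dimension measures how `μ_ξ` of a cylinder compares with
powers of `2 ^ (-g_n)`.

That comparison is a large deviation estimate. By independence the sum of `P(w) ^ (1 + t)` over
words of length `n` is at most `exp (-t H_n + 16 t² g_n)`; a Chernoff argument with `t` of either
sign shows that words with `-log₂ P(w)` off `H_n / ln 2` by a fixed multiple of `g_n`, on a given
side, have total mass at most `exp (-c g_n)`.

Upper bound (`hbDimMeasure_le_of_liminf_lt`): along levels where `H_n / (g_n ln 2)` is nearly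
minimal, typical words number at most `2 ^ (r g_n)`, and their hulls cover a limsup set of full
measure at small cost. Lower bound (`hbMeasure_ne_zero_of_lt_liminf`): off a set of mass less than
1, cylinders have mass at most `2 ^ (-a m)` where `g_n = m`; an interval of `ν*`-mass below `2 ^
(-m)` meets at most two charged cylinders, so the mass distribution principle applies. -/

lemma exp_le_quadratic (u : ℝ) : Real.exp u ≤ 1 + u + u ^ 2 * Real.exp |u| := by
  have h := Complex.norm_exp_sub_sum_le_norm_mul_exp (u : ℂ) 2
  have h2 : Complex.exp (u : ℂ) - ∑ m ∈ Finset.range 2, (u : ℂ) ^ m / (m.factorial : ℂ)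
      = ((Real.exp u - (1 + u) : ℝ) : ℂ) := by
    simp [Finset.sum_range_succ]
  rw [h2, Complex.norm_real, Complex.norm_real, Real.norm_eq_abs, Real.norm_eq_abs, sq_abs] at h
  linarith [le_abs_self (Real.exp u - (1 + u))]

/-- The error is uniform in `x`, even near `0`: for `|t| ≤ 1/2` the factor `exp |t log x|` costs at
most `x ^ (-1/2)`, and `√x log² x` is bounded by `8`. -/
lemma rpow_one_add_le {x t : ℝ} (hx : 0 < x) (hx1 : x ≤ 1) (ht : |t| ≤ 1 / 2) :
    x ^ (1 + t) ≤ x + t * (x * Real.log x) + 8 * t ^ 2 := by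
  have hlog : Real.log x ≤ 0 := Real.log_nonpos hx.le hx1
  have hu : |Real.log x * t| ≤ -Real.log x / 2 := by
    rw [abs_mul, abs_of_nonpos hlog]
    nlinarith
  have h1 := exp_le_quadratic (Real.log x * t)
  have h2 : x * Real.exp |Real.log x * t| ≤ Real.exp (Real.log x / 2) := by
    calc x * Real.exp |Real.log x * t| ≤ x * Real.exp (-Real.log x / 2) := by gcongr
      _ = Real.exp (Real.log x / 2) := by
        nth_rewrite 1 [← Real.exp_log hx]
        rw [← Real.exp_add]
        congr 1
        ring
  have h3 : Real.log x ^ 2 * Real.exp (Real.log x / 2) ≤ 8 := by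
    have hz := Real.quadratic_le_exp_of_nonneg (x := -(Real.log x / 2)) (by linarith)
    rw [Real.exp_neg] at hz
    have hpos := Real.exp_pos (Real.log x / 2)
    have h4 : Real.log x ^ 2 ≤ 8 * (Real.exp (Real.log x / 2))⁻¹ := by nlinarith
    calc Real.log x ^ 2 * Real.exp (Real.log x / 2)
        ≤ 8 * (Real.exp (Real.log x / 2))⁻¹ * Real.exp (Real.log x / 2) := by gcongr
      _ = 8 := by field_simp
  calc x ^ (1 + t) = x * Real.exp (Real.log x * t) := by
        rw [Real.rpow_add hx, Real.rpow_one, Real.rpow_def_of_pos hx]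
    _ ≤ x * (1 + Real.log x * t + (Real.log x * t) ^ 2 * Real.exp |Real.log x * t|) := by gcongr
    _ = x + t * (x * Real.log x)
        + t ^ 2 * (Real.log x ^ 2 * (x * Real.exp |Real.log x * t|)) := by ring
    _ ≤ x + t * (x * Real.log x) + t ^ 2 * (Real.log x ^ 2 * Real.exp (Real.log x / 2)) := by
        gcongr
    _ ≤ x + t * (x * Real.log x) + t ^ 2 * 8 := by gcongr
    _ = _ := by ring

lemma entropy_pos_iff {p : Fin 2 → ℕ → ℝ} {k : ℕ} (h0 : ∀ i, 0 ≤ p i k)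
    (h1 : p 0 k + p 1 k = 1) : 0 < entropy p k ↔ p 0 k ≠ 0 ∧ p 1 k ≠ 0 := by
  constructor
  · intro h
    constructor
    · intro h2
      have h3 : p 1 k = 1 := by linarith
      simp [entropy, h2, h3] at h
    · intro h2
      have h3 : p 0 k = 1 := by linarith
      simp [entropy, h2, h3] at h
  · rintro ⟨h2, h3⟩
    have a0 : 0 < p 0 k := lt_of_le_of_ne (h0 0) (Ne.symm h2)
    have a1 : 0 < p 1 k := lt_of_le_of_ne (h0 1) (Ne.symm h3)
    have b0 := Real.log_neg a0 (by linarith)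
    have b1 := Real.log_neg a1 (by linarith)
    unfold entropy
    nlinarith [mul_pos a0 (neg_pos.2 b0), mul_pos a1 (neg_pos.2 b1)]

open Classical in
-- Two digits with error `8 t²` each give `16 t²`. A degenerate digit contributes exactly `1`,
-- whence the indicator: errors accumulate like `g_n`, not like `n`.
lemma sum_rpow_one_add_le {p : Fin 2 → ℕ → ℝ} {k : ℕ} (h0 : ∀ i, 0 ≤ p i k)
    (h1 : p 0 k + p 1 k = 1) {t : ℝ} (ht : |t| ≤ 1 / 2) :
    ∑ i, p i k ^ (1 + t) ≤
      Real.exp (-t * entropy p k + 16 * t ^ 2 * if 0 < entropy p k then 1 else 0) := by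
  have ht1 : 1 + t ≠ 0 := by
    have := (abs_le.1 ht).1
    intro h
    linarith
  rw [Fin.sum_univ_two]
  split_ifs with h
  · obtain ⟨h2, h3⟩ := (entropy_pos_iff h0 h1).1 h
    have a0 : 0 < p 0 k := lt_of_le_of_ne (h0 0) (Ne.symm h2)
    have a1 : 0 < p 1 k := lt_of_le_of_ne (h0 1) (Ne.symm h3)
    have b0 := rpow_one_add_le a0 (by linarith) ht
    have b1 := rpow_one_add_le a1 (by linarith) ht
    have e := Real.add_one_le_exp (-t * entropy p k + 16 * t ^ 2 * 1)
    refine le_trans ?_ e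
    unfold entropy
    linarith
  · have h' := h
    rw [entropy_pos_iff h0 h1, not_and_or, not_not, not_not] at h'
    rcases h' with h2 | h2
    · have h3 : p 1 k = 1 := by linarith
      simp [entropy, h2, h3, Real.zero_rpow ht1]
    · have h3 : p 0 k = 1 := by linarith
      simp [entropy, h2, h3, Real.zero_rpow ht1]

/-- The product of the probabilities of the digits of a finite word. -/
def wordProb (p : Fin 2 → ℕ → ℝ) {n : ℕ} (w : Fin n → Fin 2) : ℝ :=
  ∏ k, p (w k) k

lemma wordProb_nonneg {p : Fin 2 → ℕ → ℝ} (h0 : ∀ i k, 0 ≤ p i k) {n : ℕ} (w : Fin n → Fin 2) :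
    0 ≤ wordProb p w :=
  Finset.prod_nonneg fun _ _ => h0 _ _

lemma sum_wordProb {p : Fin 2 → ℕ → ℝ} (h1 : ∀ k, p 0 k + p 1 k = 1) (n : ℕ) :
    ∑ w : Fin n → Fin 2, wordProb p w = 1 := by
  unfold wordProb
  rw [← Fintype.prod_sum fun (k : Fin n) (i : Fin 2) => p i k]
  simp [Fin.sum_univ_two, h1]

lemma sum_wordProb_rpow_le {p : Fin 2 → ℕ → ℝ} (h0 : ∀ i k, 0 ≤ p i k)
    (h1 : ∀ k, p 0 k + p 1 k = 1) (n : ℕ) {t : ℝ} (ht : |t| ≤ 1 / 2) :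
    ∑ w : Fin n → Fin 2, wordProb p w ^ (1 + t) ≤
      Real.exp (-t * entropySum p n + 16 * t ^ 2 * positiveCount p n) := by
  classical
  calc ∑ w : Fin n → Fin 2, wordProb p w ^ (1 + t)
      = ∑ w : Fin n → Fin 2, ∏ k : Fin n, p (w k) k ^ (1 + t) :=
        Finset.sum_congr rfl fun w _ => (Real.finsetProd_rpow _ _ (fun _ _ => h0 _ _) _).symm
    _ = ∏ k : Fin n, ∑ i, p i k ^ (1 + t) :=
        (Fintype.prod_sum fun (k : Fin n) (i : Fin 2) => p i k ^ (1 + t)).symm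
    _ = ∏ k ∈ Finset.range n, ∑ i, p i k ^ (1 + t) :=
        Fin.prod_univ_eq_prod_range (fun k => ∑ i, p i k ^ (1 + t)) n
    _ ≤ ∏ k ∈ Finset.range n, Real.exp
          (-t * entropy p k + 16 * t ^ 2 * if 0 < entropy p k then 1 else 0) :=
        Finset.prod_le_prod (fun k _ => Finset.sum_nonneg fun i _ => Real.rpow_nonneg (h0 _ _) _)
          fun k _ => sum_rpow_one_add_le (fun i => h0 i k) (h1 k) ht
    _ = _ := by
        rw [← Real.exp_sum, Finset.sum_add_distrib, ← Finset.mul_sum, ← Finset.mul_sum,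
          Finset.sum_boole, entropySum, positiveCount]

/-- Chernoff bound: on `S` the weight `(2 ^ (a g) P(w)) ^ t` is at least `1`. Positive `t` handles
words that are too probable, negative `t` those that are too improbable. Null words contribute
nothing and are exempted from `hS`, since `Real.log 0` is a default value. -/
lemma sum_wordProb_filter_le {p : Fin 2 → ℕ → ℝ} (h0 : ∀ i k, 0 ≤ p i k)
    (h1 : ∀ k, p 0 k + p 1 k = 1) {n : ℕ} {a b t : ℝ} (ht : |t| ≤ 1 / 2)
    (hn : 0 ≤ t * (entropySum p n - b * (positiveCount p n * Real.log 2)))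
    (S : Finset (Fin n → Fin 2))
    (hS : ∀ w ∈ S, wordProb p w ≠ 0 →
      0 ≤ t * (Real.log (wordProb p w) + a * positiveCount p n * Real.log 2)) :
    ∑ w ∈ S, wordProb p w ≤
      Real.exp (-((t * ((b - a) * Real.log 2) - 16 * t ^ 2) * positiveCount p n)) := by
  set g : ℝ := (positiveCount p n : ℝ) with hg
  have ht1 : 1 + t ≠ 0 := by
    have := (abs_le.1 ht).1
    intro h
    linarith
  calc ∑ w ∈ S, wordProb p w
      ≤ ∑ w ∈ S, Real.exp (t * (a * g * Real.log 2)) * wordProb p w ^ (1 + t) := by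
        refine Finset.sum_le_sum fun w hw => ?_
        rcases (wordProb_nonneg h0 w).eq_or_lt with h | h
        · rw [← h, Real.zero_rpow ht1, mul_zero]
        · have h2 := hS w hw h.ne'
          rw [Real.rpow_add h, Real.rpow_one, Real.rpow_def_of_pos h, mul_left_comm,
            ← Real.exp_add]
          refine le_mul_of_one_le_right h.le (Real.one_le_exp ?_)
          linarith
    _ ≤ ∑ w : Fin n → Fin 2, Real.exp (t * (a * g * Real.log 2)) * wordProb p w ^ (1 + t) :=
        Finset.sum_le_sum_of_subset_of_nonneg (Finset.subset_univ _) fun w _ _ =>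
          mul_nonneg (Real.exp_pos _).le (Real.rpow_nonneg (wordProb_nonneg h0 w) _)
    _ ≤ Real.exp (t * (a * g * Real.log 2)) * Real.exp (-t * entropySum p n + 16 * t ^ 2 * g) := by
        rw [← Finset.mul_sum]
        gcongr
        exact sum_wordProb_rpow_le h0 h1 n ht
    _ ≤ _ := by
        rw [← Real.exp_add]
        apply Real.exp_le_exp.2
        linarith

/-- A small parameter for which the quadratic error is dominated by the linear gain. -/
lemma exists_pos_quadratic_lt {e : ℝ} (he : 0 < e) :
    ∃ t : ℝ, 0 < t ∧ t ≤ 1 / 2 ∧ 0 < t * e - 16 * t ^ 2 := by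
  -- For `t ≤ e / 32` the error `16 t²` is at most half of `t e`.
  refine ⟨min (1 / 2) (e / 32), by positivity, min_le_left _ _, ?_⟩
  have h1 : min (1 / 2) (e / 32) ≤ e / 32 := min_le_right _ _
  have h2 : 0 < min (1 / 2) (e / 32) := by positivity
  nlinarith

/-- The total probability of the words that are much more probable than their entropy
suggests is exponentially small. -/
lemma sum_wordProb_of_lt_le {p : Fin 2 → ℕ → ℝ} (h0 : ∀ i k, 0 ≤ p i k)
    (h1 : ∀ k, p 0 k + p 1 k = 1) {a b : ℝ} (hab : a < b) :
    ∃ c > 0, ∀ n, b * (positiveCount p n * Real.log 2) ≤ entropySum p n →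
      ∑ w : Fin n → Fin 2 with (2 : ℝ) ^ (-(a * positiveCount p n)) < wordProb p w, wordProb p w
        ≤ Real.exp (-(c * positiveCount p n)) := by
  have hlog : 0 < Real.log 2 := Real.log_pos one_lt_two
  obtain ⟨t, ht0, ht, hc⟩ := exists_pos_quadratic_lt (mul_pos (sub_pos.2 hab) hlog)
  refine ⟨_, hc, fun n hn => sum_wordProb_filter_le h0 h1 ?_ ?_ _ ?_⟩
  · rwa [abs_of_pos ht0]
  · exact mul_nonneg ht0.le (sub_nonneg.2 hn)
  · intro w hw _
    have h2 := Real.log_lt_log (by positivity) (Finset.mem_filter.1 hw).2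
    rw [Real.log_rpow two_pos] at h2
    exact mul_nonneg ht0.le (by linarith)

/-- The total probability of the words that are much less probable than their entropy
suggests is exponentially small. -/
lemma sum_wordProb_of_gt_le {p : Fin 2 → ℕ → ℝ} (h0 : ∀ i k, 0 ≤ p i k)
    (h1 : ∀ k, p 0 k + p 1 k = 1) {a b : ℝ} (hab : b < a) :
    ∃ c > 0, ∀ n, entropySum p n ≤ b * (positiveCount p n * Real.log 2) →
      ∑ w : Fin n → Fin 2 with wordProb p w < (2 : ℝ) ^ (-(a * positiveCount p n)), wordProb p w
        ≤ Real.exp (-(c * positiveCount p n)) := by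
  have hlog : 0 < Real.log 2 := Real.log_pos one_lt_two
  obtain ⟨t, ht0, ht, hc⟩ := exists_pos_quadratic_lt (mul_pos (sub_pos.2 hab) hlog)
  refine ⟨_, hc, fun n hn => (sum_wordProb_filter_le (a := a) (b := b) (t := -t) h0 h1
    ?_ ?_ _ ?_).trans_eq ?_⟩
  · rwa [abs_neg, abs_of_pos ht0]
  · nlinarith
  · intro w hw hw0
    have h3 : 0 < wordProb p w := lt_of_le_of_ne (wordProb_nonneg h0 w) hw0.symm
    have h2 := Real.log_lt_log h3 (Finset.mem_filter.1 hw).2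
    rw [Real.log_rpow two_pos] at h2
    nlinarith
  · congr 1
    ring

lemma card_wordProb_ge_le {p : Fin 2 → ℕ → ℝ} (h0 : ∀ i k, 0 ≤ p i k)
    (h1 : ∀ k, p 0 k + p 1 k = 1) (n : ℕ) {r : ℝ} :
    ((Finset.univ.filter fun w : Fin n → Fin 2 => r ≤ wordProb p w).card : ℝ) * r ≤ 1 := by
  rw [← sum_wordProb h1 n, ← nsmul_eq_mul]
  exact (Finset.card_nsmul_le_sum _ _ _ fun w hw => (Finset.mem_filter.1 hw).2).trans
    (Finset.sum_le_sum_of_subset_of_nonneg (Finset.subset_univ _) fun w _ _ =>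
      wordProb_nonneg h0 w)

/-! ### The number of digits with positive entropy -/

lemma positiveCount_zero (p : Fin 2 → ℕ → ℝ) : positiveCount p 0 = 0 := by
  simp [positiveCount]

open Classical in
lemma positiveCount_succ (p : Fin 2 → ℕ → ℝ) (n : ℕ) :
    positiveCount p (n + 1) = positiveCount p n + if 0 < entropy p n then 1 else 0 := by
  unfold positiveCount
  rw [Finset.range_add_one, Finset.filter_insert]
  split_ifs <;> simp

lemma positiveCount_le (p : Fin 2 → ℕ → ℝ) (n : ℕ) : positiveCount p n ≤ n := by
  classical
  exact (Finset.card_filter_le _ _).trans_eq (Finset.card_range n)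

lemma positiveCount_mono (p : Fin 2 → ℕ → ℝ) : Monotone (positiveCount p) := by
  classical
  refine monotone_nat_of_le_succ fun n => ?_
  rw [positiveCount_succ]
  exact Nat.le_add_right _ _

/-- The count is unbounded with steps of `0` or `1`, so it skips no value. The lower bound needs a
level for every dyadic scale. -/
lemma exists_positiveCount_eq {p : Fin 2 → ℕ → ℝ} (hinf : {k | 0 < entropy p k}.Infinite)
    (m : ℕ) : ∃ n, positiveCount p n = m := by
  classical
  induction m with
  | zero => exact ⟨0, positiveCount_zero p⟩
  | succ m ih =>
    obtain ⟨n, hn⟩ := ih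
    have hex : ∃ k, n ≤ k ∧ 0 < entropy p k := by
      obtain ⟨k, hk, hnk⟩ := hinf.exists_gt n
      exact ⟨k, hnk.le, hk⟩
    obtain ⟨hk1, hk2⟩ := Nat.find_spec hex
    refine ⟨Nat.find hex + 1, ?_⟩
    have hstep : ∀ j, n ≤ j → j ≤ Nat.find hex → positiveCount p j = m := by
      intro j hj
      induction j, hj using Nat.le_induction with
      | base => exact fun _ => hn
      | succ j hj ih =>
        intro hj2
        have h3 := Nat.find_min hex hj2
        have h4 : ¬ 0 < entropy p j := fun h => h3 ⟨hj, h⟩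
        rw [positiveCount_succ, ih (by omega), if_neg h4, add_zero]
    rw [positiveCount_succ, hstep _ hk1 le_rfl, if_pos hk2]

lemma tendsto_positiveCount {p : Fin 2 → ℕ → ℝ} (hinf : {k | 0 < entropy p k}.Infinite) :
    Tendsto (positiveCount p) atTop atTop :=
  tendsto_atTop_atTop_of_monotone (positiveCount_mono p) fun m =>
    (exists_positiveCount_eq hinf m).imp fun _ h => h.ge

/-! ### Probabilities of words under the uniform distribution -/

lemma uniformProb_nonneg (p : Fin 2 → ℕ → ℝ) (i : Fin 2) (k : ℕ) : 0 ≤ uniformProb p i k := by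
  unfold uniformProb
  split_ifs <;> norm_num

open Classical in
lemma uniformProb_eq {p : Fin 2 → ℕ → ℝ} {k : ℕ} (h0 : ∀ i, 0 ≤ p i k)
    (h1 : p 0 k + p 1 k = 1) {i : Fin 2} (hi : p i k ≠ 0) :
    uniformProb p i k = (1 / 2) ^ (if 0 < entropy p k then 1 else 0) := by
  have h := entropy_pos_iff h0 h1
  unfold uniformProb
  rw [if_neg hi]
  by_cases h2 : 0 < entropy p k
  · have h3 : p i k ≠ 1 := by
      have := h.1 h2
      intro h4
      fin_cases i
      · exact this.2 (by simp at h4; linarith)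
      · exact this.1 (by simp at h4; linarith)
    rw [if_neg h3, if_pos h2, pow_one]
  · have h3 : p i k = 1 := by
      rw [h, not_and_or, not_not, not_not] at h2
      fin_cases i
      · simp only [Fin.zero_eta] at hi ⊢
        linarith [h2.resolve_left hi]
      · simp only [Fin.mk_one] at hi ⊢
        linarith [h2.resolve_right hi]
    rw [if_pos h3, if_neg h2, pow_zero]

open Classical in
lemma uniformProb_le {p : Fin 2 → ℕ → ℝ} {k : ℕ} (h0 : ∀ i, 0 ≤ p i k)
    (h1 : p 0 k + p 1 k = 1) (i : Fin 2) :
    uniformProb p i k ≤ (1 / 2) ^ (if 0 < entropy p k then 1 else 0) := by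
  by_cases hi : p i k = 0
  · rw [uniformProb, if_pos hi]
    positivity
  · exact (uniformProb_eq h0 h1 hi).le

open Classical in
lemma prod_half_pow_eq (p : Fin 2 → ℕ → ℝ) (n : ℕ) :
    ∏ k : Fin n, ((1 / 2 : ℝ) ^ (if 0 < entropy p k then 1 else 0)) =
      (1 / 2) ^ positiveCount p n := by
  rw [Fin.prod_univ_eq_prod_range (fun k => (1 / 2 : ℝ) ^ (if 0 < entropy p k then 1 else 0)),
    Finset.prod_pow_eq_pow_sum, Finset.sum_boole]
  rfl

lemma wordProb_uniformProb_le {p : Fin 2 → ℕ → ℝ} (h0 : ∀ i k, 0 ≤ p i k)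
    (h1 : ∀ k, p 0 k + p 1 k = 1) {n : ℕ} (w : Fin n → Fin 2) :
    wordProb (uniformProb p) w ≤ (1 / 2) ^ positiveCount p n := by
  classical
  rw [← prod_half_pow_eq]
  exact Finset.prod_le_prod (fun _ _ => uniformProb_nonneg _ _ _)
    fun k _ => uniformProb_le (fun i => h0 i k) (h1 k) _

/-- Equality requires a charged word: a word using a forbidden digit has uniform mass `0`. -/
lemma wordProb_uniformProb_eq {p : Fin 2 → ℕ → ℝ} (h0 : ∀ i k, 0 ≤ p i k)
    (h1 : ∀ k, p 0 k + p 1 k = 1) {n : ℕ} {w : Fin n → Fin 2} (hw : wordProb p w ≠ 0) :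
    wordProb (uniformProb p) w = (1 / 2) ^ positiveCount p n := by
  classical
  rw [← prod_half_pow_eq]
  exact Finset.prod_congr rfl fun k _ =>
    uniformProb_eq (fun i => h0 i k) (h1 k) (Finset.prod_ne_zero_iff.1 hw k (Finset.mem_univ k))

/-! ### The sum of an incomplete alternating series as a function of its digits -/

namespace IsSecondOstrogradsky

lemma one_le {q : ℕ → ℕ} (hq : IsSecondOstrogradsky q) (k : ℕ) : (1 : ℝ) ≤ q k := by
  exact_mod_cast (hq k).1

lemma two_mul_le {q : ℕ → ℕ} (hq : IsSecondOstrogradsky q) (k : ℕ) :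
    (2 : ℝ) * q k ≤ q (k + 1) := by
  have h := (hq k).2
  have h1 := (hq k).1
  have : 2 * q k ≤ q (k + 1) := by nlinarith
  exact_mod_cast this

/-- From the second term on `q ≥ 2`, so the ratio is at least `3`. Ratio `2` alone would only bound
the tail by `1 / q n`, a tie with the leading term. -/
lemma three_mul_le {q : ℕ → ℕ} (hq : IsSecondOstrogradsky q) (k : ℕ) :
    (3 : ℝ) * q (k + 1) ≤ q (k + 2) := by
  have h := (hq (k + 1)).2
  have h2 := (hq k).2
  have h1 := (hq k).1
  have h3 : 2 ≤ q (k + 1) := by nlinarith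
  have : 3 * q (k + 1) ≤ q (k + 2) := by
    change q (k + 1) * (q (k + 1) + 1) ≤ q (k + 2) at h
    nlinarith
  exact_mod_cast this

lemma two_pow_le {q : ℕ → ℕ} (hq : IsSecondOstrogradsky q) (k : ℕ) : (2 : ℝ) ^ k ≤ q k := by
  induction k with
  | zero => simpa using hq.one_le 0
  | succ k ih => rw [pow_succ]; linarith [hq.two_mul_le k]

lemma mul_three_pow_le {q : ℕ → ℕ} (hq : IsSecondOstrogradsky q) (n j : ℕ) :
    (2 : ℝ) * q n * 3 ^ j ≤ q (j + (n + 1)) := by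
  induction j with
  | zero => simpa using hq.two_mul_le n
  | succ j ih =>
    have := hq.three_mul_le (n + j)
    rw [show j + 1 + (n + 1) = n + j + 2 by ring, pow_succ]
    rw [show j + (n + 1) = n + j + 1 by ring] at ih
    linarith

end IsSecondOstrogradsky

/-- The `k`-th term of the series with digits `d`. -/
noncomputable def digitTerm (q : ℕ → ℕ) (d : ℕ → Fin 2) (k : ℕ) : ℝ :=
  (-1 : ℝ) ^ k * ((d k : ℕ) : ℝ) / (q k : ℝ)

/-- The sum of the series with digits `d`. -/
noncomputable def digitSum (q : ℕ → ℕ) (d : ℕ → Fin 2) : ℝ :=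
  ∑' k, digitTerm q d k

lemma digit_le_one (i : Fin 2) : ((i : ℕ) : ℝ) ≤ 1 := by
  exact_mod_cast Nat.le_of_lt_succ i.2

lemma norm_digitTerm_le {q : ℕ → ℕ} (hq : IsSecondOstrogradsky q) (d : ℕ → Fin 2) (k : ℕ) :
    ‖digitTerm q d k‖ ≤ (1 / 2) ^ k := by
  have h := hq.two_pow_le k
  rw [digitTerm, norm_div, norm_mul, norm_pow, norm_neg, norm_one, one_pow, one_mul,
    Real.norm_natCast, Real.norm_natCast, one_div, inv_pow, ← one_div]
  exact div_le_div₀ zero_le_one (digit_le_one _) (by positivity) h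

lemma summable_digitTerm {q : ℕ → ℕ} (hq : IsSecondOstrogradsky q) (d : ℕ → Fin 2) :
    Summable (digitTerm q d) :=
  Summable.of_norm_bounded summable_geometric_two (norm_digitTerm_le hq d)

lemma continuous_digitSum {q : ℕ → ℕ} (hq : IsSecondOstrogradsky q) :
    Continuous (digitSum q) := by
  refine continuous_tsum (fun k => ?_) summable_geometric_two fun k d => norm_digitTerm_le hq d k
  have h : Continuous fun i : Fin 2 => (-1 : ℝ) ^ k * ((i : ℕ) : ℝ) / (q k : ℝ) :=
    continuous_of_discreteTopology
  exact h.comp (continuous_apply k)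

/-- The order of two sums is decided by the first digit in which they differ. -/
lemma neg_one_pow_mul_digitSum_sub_pos {q : ℕ → ℕ} (hq : IsSecondOstrogradsky q)
    {d e : ℕ → Fin 2} {n : ℕ} (hde : ∀ k < n, d k = e k) (hd : d n = 1) (he : e n = 0) :
    0 < (-1 : ℝ) ^ n * (digitSum q d - digitSum q e) := by
  set f : ℕ → ℝ := fun k => digitTerm q d k - digitTerm q e k with hf
  have hfs : Summable f := (summable_digitTerm hq d).sub (summable_digitTerm hq e)
  have h1 : digitSum q d - digitSum q e = ∑' k, f k :=
    ((summable_digitTerm hq d).tsum_sub (summable_digitTerm hq e)).symm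
  have hqn : (0 : ℝ) < q n := zero_lt_one.trans_le (hq.one_le n)
  have h2 : ∑ k ∈ Finset.range (n + 1), f k = (-1 : ℝ) ^ n / q n := by
    rw [Finset.sum_range_succ, Finset.sum_eq_zero, zero_add]
    · simp [hf, digitTerm, hd, he]
    · intro k hk
      simp [hf, digitTerm, hde k (Finset.mem_range.1 hk)]
  -- The geometric majorant sums to `(3/4) / q n`, strictly below the leading term `1 / q n`.
  have h3 : ‖∑' k, f (k + (n + 1))‖ ≤ 1 / (2 * q n) * (1 - 1 / 3)⁻¹ := by
    refine tsum_of_norm_bounded ((hasSum_geometric_of_lt_one (r := 1 / 3)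
      (by norm_num) (by norm_num)).mul_left (1 / (2 * (q n : ℝ)))) fun j => ?_
    have h4 := hq.mul_three_pow_le n j
    have h5 : f (j + (n + 1)) = (-1 : ℝ) ^ (j + (n + 1)) *
        (((d (j + (n + 1)) : ℕ) : ℝ) - ((e (j + (n + 1)) : ℕ) : ℝ)) / (q (j + (n + 1)) : ℝ) := by
      simp only [hf, digitTerm]
      ring
    have h6 : |((d (j + (n + 1)) : ℕ) : ℝ) - ((e (j + (n + 1)) : ℕ) : ℝ)| ≤ 1 := by
      rw [abs_le]
      have a1 := digit_le_one (d (j + (n + 1)))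
      have a2 := digit_le_one (e (j + (n + 1)))
      have a3 : (0 : ℝ) ≤ ((d (j + (n + 1)) : ℕ) : ℝ) := Nat.cast_nonneg _
      have a4 : (0 : ℝ) ≤ ((e (j + (n + 1)) : ℕ) : ℝ) := Nat.cast_nonneg _
      constructor <;> linarith
    rw [h5, norm_div, norm_mul, norm_pow, norm_neg, norm_one, one_pow, one_mul,
      Real.norm_natCast, Real.norm_eq_abs, one_div_pow, one_div_mul_one_div]
    exact div_le_div₀ zero_le_one h6 (by positivity) h4
  have h7 : |(-1 : ℝ) ^ n * ∑' k, f (k + (n + 1))| ≤ 3 / 4 / q n := by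
    rw [abs_mul, abs_neg_one_pow, one_mul]
    refine h3.trans_eq ?_
    field_simp
    norm_num
  rw [h1, ← hfs.sum_add_tsum_nat_add (n + 1), h2, mul_add, mul_div_assoc', ← mul_pow]
  have h8 := (abs_le.1 h7).1
  have h9 : (3 / 4 / q n : ℝ) < (-1 * -1) ^ n / q n := by
    rw [neg_one_mul, neg_neg, one_pow]
    gcongr
    norm_num
  linarith

lemma digit_cases {a b : Fin 2} (h : a ≠ b) : (a = 1 ∧ b = 0) ∨ (b = 1 ∧ a = 0) := by
  omega

lemma exists_first_ne {d e : ℕ → Fin 2} {n : ℕ} (h : ∃ k < n, d k ≠ e k) :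
    ∃ k < n, d k ≠ e k ∧ ∀ j < k, d j = e j := by
  classical
  have h' : ∃ k, d k ≠ e k := h.imp fun _ hk => hk.2
  obtain ⟨m, hm, hne⟩ := h
  exact ⟨Nat.find h', (Nat.find_min' h' hne).trans_lt hm, Nat.find_spec h',
    fun j hj => not_not.1 (Nat.find_min h' hj)⟩

lemma digitSum_injective {q : ℕ → ℕ} (hq : IsSecondOstrogradsky q) :
    Function.Injective (digitSum q) := by
  intro d e h
  by_contra hne
  obtain ⟨k, hk⟩ := Function.ne_iff.1 hne
  obtain ⟨n, -, hn, hlt⟩ := exists_first_ne ⟨k, k.lt_succ_self, hk⟩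
  rcases digit_cases hn with ⟨h1, h2⟩ | ⟨h1, h2⟩
  · simpa [h] using neg_one_pow_mul_digitSum_sub_pos hq hlt h1 h2
  · simpa [h] using neg_one_pow_mul_digitSum_sub_pos hq (fun j hj => (hlt j hj).symm) h1 h2

/-- If two digit sequences have different prefixes of length `n`, then the order of their sums
is determined by these prefixes. -/
lemma digitSum_lt_of_prefix {q : ℕ → ℕ} (hq : IsSecondOstrogradsky q) {d e d' e' : ℕ → Fin 2}
    {n : ℕ} (hne : ∃ k < n, d k ≠ e k) (hd : ∀ k < n, d' k = d k) (he : ∀ k < n, e' k = e k)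
    (h : digitSum q d < digitSum q e) : digitSum q d' < digitSum q e' := by
  obtain ⟨k, hk, hkne, hlt⟩ := exists_first_ne hne
  have hlt' : ∀ j < k, d' j = e' j := fun j hj => by
    rw [hd j (hj.trans hk), he j (hj.trans hk), hlt j hj]
  rw [← sub_pos] at h ⊢
  rcases digit_cases hkne with ⟨h1, h2⟩ | ⟨h1, h2⟩
  · have a := neg_one_pow_mul_digitSum_sub_pos hq hlt h1 h2
    have b := neg_one_pow_mul_digitSum_sub_pos hq hlt' ((hd k hk).trans h1) ((he k hk).trans h2)
    rcases neg_one_pow_eq_or ℝ k with hs | hs <;> rw [hs] at a b <;> linarith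
  · have a := neg_one_pow_mul_digitSum_sub_pos hq (fun j hj => (hlt j hj).symm) h1 h2
    have b := neg_one_pow_mul_digitSum_sub_pos hq (fun j hj => (hlt' j hj).symm)
      ((he k hk).trans h1) ((hd k hk).trans h2)
    rcases neg_one_pow_eq_or ℝ k with hs | hs <;> rw [hs] at a b <;> linarith

/-! ### Cylinders -/

/-- The first `n` digits of a digit sequence. -/
def digitPrefix (n : ℕ) (d : ℕ → Fin 2) : Fin n → Fin 2 := fun k => d k

lemma digitPrefix_eq_iff {n : ℕ} {d e : ℕ → Fin 2} :
    digitPrefix n d = digitPrefix n e ↔ ∀ k < n, d k = e k :=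
  ⟨fun h k hk => congrFun h ⟨k, hk⟩, fun h => funext fun k => h k k.2⟩

lemma digitSum_lt_of_digitPrefix {q : ℕ → ℕ} (hq : IsSecondOstrogradsky q) {n : ℕ}
    {d e d' e' : ℕ → Fin 2} (hne : digitPrefix n d ≠ digitPrefix n e)
    (hd : digitPrefix n d' = digitPrefix n d) (he : digitPrefix n e' = digitPrefix n e)
    (h : digitSum q d < digitSum q e) : digitSum q d' < digitSum q e' := by
  refine digitSum_lt_of_prefix hq ?_ (digitPrefix_eq_iff.1 hd) (digitPrefix_eq_iff.1 he) h
  by_contra! hcon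
  exact hne (digitPrefix_eq_iff.2 hcon)

lemma continuous_digitPrefix (n : ℕ) : Continuous (digitPrefix n) :=
  continuous_pi fun k => continuous_apply (k : ℕ)

lemma measurable_digitPrefix (n : ℕ) : Measurable (digitPrefix n) :=
  (continuous_digitPrefix n).measurable

/-- The closed interval spanned by the sums whose digits begin with `w`. -/
lemma exists_hull {q : ℕ → ℕ} (hq : IsSecondOstrogradsky q) {n : ℕ} (w : Fin n → Fin 2) :
    ∃ I ∈ closedIntervals, digitSum q ⁻¹' I = digitPrefix n ⁻¹' {w} := by
  set C : Set (ℕ → Fin 2) := digitPrefix n ⁻¹' {w} with hC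
  have hcomp : IsCompact C := (isClosed_singleton.preimage (continuous_digitPrefix n)).isCompact
  have hne : C.Nonempty :=
    ⟨fun k => if h : k < n then w ⟨k, h⟩ else 0, by
      ext k
      simp [digitPrefix]⟩
  obtain ⟨a, ha, hamin⟩ := hcomp.exists_isMinOn hne (continuous_digitSum hq).continuousOn
  obtain ⟨b, hb, hbmax⟩ := hcomp.exists_isMaxOn hne (continuous_digitSum hq).continuousOn
  refine ⟨Set.Icc (digitSum q a) (digitSum q b), ⟨_, _, hamin hb, rfl⟩, ?_⟩
  apply Set.Subset.antisymm
  -- If `d` had another prefix, its sum would exceed that of `a`, hence also that of `b`, which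
  -- shares the prefix of `a`.
  · rintro d ⟨had, hdb⟩
    by_contra hd
    have hda : digitPrefix n a ≠ digitPrefix n d := fun h => hd (h.symm.trans ha)
    have hba : digitPrefix n b = digitPrefix n a := Eq.trans hb (Eq.symm ha)
    have had' : digitSum q a < digitSum q d :=
      lt_of_le_of_ne had fun h => hda (by rw [digitSum_injective hq h])
    exact absurd hdb (not_le.2 (digitSum_lt_of_digitPrefix hq hda hba rfl had'))
  · exact fun d hd => ⟨hamin hd, hbmax hd⟩

/-! ### The law of the digits -/

lemma IsBernoulliSequence.nonneg {Ω : Type*} [MeasurableSpace Ω] {P : Measure Ω}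
    {ξ : ℕ → Ω → ℝ} {p : Fin 2 → ℕ → ℝ} (hξ : IsBernoulliSequence P ξ p) (i : Fin 2) (k : ℕ) :
    0 ≤ p i k := by
  fin_cases i
  · exact (hξ.prob_zero k).symm ▸ measureReal_nonneg
  · exact (hξ.prob_one k).symm ▸ measureReal_nonneg

lemma IsBernoulliSequence.measure_preimage {Ω : Type*} [MeasurableSpace Ω] {P : Measure Ω}
    [IsProbabilityMeasure P] {ξ : ℕ → Ω → ℝ} {p : Fin 2 → ℕ → ℝ}
    (hξ : IsBernoulliSequence P ξ p) (i : Fin 2) (k : ℕ) :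
    P (ξ k ⁻¹' {((i : ℕ) : ℝ)}) = ENNReal.ofReal (p i k) := by
  fin_cases i
  · rw [← ofReal_measureReal]
    simp [← hξ.prob_zero k, Set.preimage]
  · rw [← ofReal_measureReal]
    simp [← hξ.prob_one k, Set.preimage]

lemma IsBernoulliSequence.ae_eq_zero_or_one {Ω : Type*} [MeasurableSpace Ω] {P : Measure Ω}
    [IsProbabilityMeasure P] {ξ : ℕ → Ω → ℝ} {p : Fin 2 → ℕ → ℝ}
    (hξ : IsBernoulliSequence P ξ p) (k : ℕ) : ∀ᵐ ω ∂P, ξ k ω = 0 ∨ ξ k ω = 1 := by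
  have hm0 : MeasurableSet {ω | ξ k ω = 0} := hξ.measurable k (measurableSet_singleton 0)
  have hm1 : MeasurableSet {ω | ξ k ω = 1} := hξ.measurable k (measurableSet_singleton 1)
  have hdisj : Disjoint {ω | ξ k ω = 0} {ω | ξ k ω = 1} := by
    rw [Set.disjoint_left]
    intro ω h0 h1
    exact zero_ne_one (Eq.trans (Eq.symm h0) h1)
  have h : P.real ({ω | ξ k ω = 0} ∪ {ω | ξ k ω = 1}) = 1 := by
    rw [measureReal_union hdisj hm1, hξ.prob_zero, hξ.prob_one, hξ.sum_eq_one]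
  have h2 : P ({ω | ξ k ω = 0} ∪ {ω | ξ k ω = 1}) = 1 := by
    rw [← ofReal_measureReal, h, ENNReal.ofReal_one]
  exact (mem_ae_iff_prob_eq_one (hm0.union hm1)).2 h2

/-- This moves the problem to digit space; the dimension bounds then use only the masses of
cylinders. -/
lemma IsBernoulliSequence.exists_digit_law {Ω : Type*} [MeasurableSpace Ω] {P : Measure Ω}
    [IsProbabilityMeasure P] {ξ : ℕ → Ω → ℝ} {p : Fin 2 → ℕ → ℝ}
    (hξ : IsBernoulliSequence P ξ p) {q : ℕ → ℕ} (hq : IsSecondOstrogradsky q) :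
    ∃ M : Measure (ℕ → Fin 2), IsProbabilityMeasure M ∧
      seriesLaw P ξ q = M.map (digitSum q) ∧
      ∀ (n : ℕ) (w : Fin n → Fin 2),
        M (digitPrefix n ⁻¹' {w}) = ENNReal.ofReal (wordProb p w) := by
  classical
  -- Values other than `0` and `1` occur with probability zero; they are sent to the digit `0`.
  set D : Ω → ℕ → Fin 2 := fun ω k => if ξ k ω = 1 then 1 else 0 with hD
  have hDm : Measurable D := measurable_pi_lambda _ fun k =>
    Measurable.ite (hξ.measurable k (measurableSet_singleton 1)) measurable_const measurable_const
  have hae : ∀ᵐ ω ∂P, ∀ k, ξ k ω = ((D ω k : ℕ) : ℝ) := by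
    rw [ae_all_iff]
    intro k
    filter_upwards [hξ.ae_eq_zero_or_one k] with ω hω
    rcases hω with h | h <;> simp [hD, h]
  refine ⟨P.map D, Measure.isProbabilityMeasure_map hDm.aemeasurable, ?_, fun n w => ?_⟩
  · rw [Measure.map_map (continuous_digitSum hq).measurable hDm]
    refine Measure.map_congr ?_
    filter_upwards [hae] with ω hω
    simp only [Function.comp_apply, digitSum, digitTerm, hω]
  · rw [Measure.map_apply hDm (measurable_digitPrefix n (measurableSet_singleton w))]
    have h1 : D ⁻¹' (digitPrefix n ⁻¹' {w}) =ᵐ[P]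
        (⋂ k ∈ (Finset.univ : Finset (Fin n)), ξ k ⁻¹' {((w k : ℕ) : ℝ)} : Set Ω) := by
      filter_upwards [hae] with ω hω
      apply propext
      change D ω ∈ digitPrefix n ⁻¹' {w} ↔
        ω ∈ ⋂ k ∈ (Finset.univ : Finset (Fin n)), ξ k ⁻¹' {((w k : ℕ) : ℝ)}
      simp only [Set.mem_preimage, Set.mem_singleton_iff, Finset.mem_univ, Set.iInter_true,
        Set.mem_iInter, hω, Nat.cast_inj, Fin.val_inj, funext_iff, digitPrefix]
    have h2 : iIndepFun (fun k : Fin n => ξ k) P := hξ.indep.precomp Fin.val_injective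
    rw [measure_congr h1, h2.measure_inter_preimage_eq_mul Finset.univ
      fun k _ => measurableSet_singleton _, wordProb,
      ENNReal.ofReal_prod_of_nonneg fun k _ => hξ.nonneg _ _]
    exact Finset.prod_congr rfl fun k _ => hξ.measure_preimage _ _

lemma measure_digitPrefix_mem_le {M : Measure (ℕ → Fin 2)} {p : Fin 2 → ℕ → ℝ}
    (h0 : ∀ i k, 0 ≤ p i k) {n : ℕ}
    (hM : ∀ w : Fin n → Fin 2, M (digitPrefix n ⁻¹' {w}) = ENNReal.ofReal (wordProb p w))
    (S : Finset (Fin n → Fin 2)) :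
    M (digitPrefix n ⁻¹' S) ≤ ENNReal.ofReal (∑ w ∈ S, wordProb p w) := by
  have h : digitPrefix n ⁻¹' (S : Set (Fin n → Fin 2)) = ⋃ w ∈ S, digitPrefix n ⁻¹' {w} := by
    ext d
    simp
  rw [h, ENNReal.ofReal_sum_of_nonneg fun w _ => wordProb_nonneg h0 w]
  exact (measure_biUnion_finset_le _ _).trans_eq (Finset.sum_congr rfl fun w _ => hM w)

lemma measurableEmbedding_digitSum {q : ℕ → ℕ} (hq : IsSecondOstrogradsky q) :
    MeasurableEmbedding (digitSum q) :=
  ((continuous_digitSum hq).isClosedEmbedding (digitSum_injective hq)).measurableEmbedding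

/-! ### The upper bound -/

lemma ofReal_half_pow (g : ℕ) : ENNReal.ofReal ((1 / 2) ^ g) = 2⁻¹ ^ g := by
  rw [ENNReal.ofReal_pow (by norm_num), one_div, ENNReal.ofReal_inv_of_pos two_pos,
    ENNReal.ofReal_ofNat]

lemma le_mul_of_ofReal_div_lt {H : ℝ} {g : ℕ} {b : ℝ≥0} (hg : 0 < g)
    (h : ENNReal.ofReal (H / (g * Real.log 2)) < b) : H ≤ b * (g * Real.log 2) := by
  have hpos : 0 < (g : ℝ) * Real.log 2 :=
    mul_pos (Nat.cast_pos.2 hg) (Real.log_pos one_lt_two)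
  rw [← div_le_iff₀ hpos]
  by_contra! hcon
  refine absurd h (not_lt.2 ?_)
  rw [← ENNReal.ofReal_coe_nnreal]
  exact ENNReal.ofReal_le_ofReal hcon.le

lemma mul_le_of_lt_ofReal_div {H : ℝ} {g : ℕ} {b : ℝ≥0}
    (h : (b : ℝ≥0∞) < ENNReal.ofReal (H / (g * Real.log 2))) :
    b * (g * Real.log 2) ≤ H := by
  rw [← ENNReal.ofReal_coe_nnreal] at h
  have h1 : (b : ℝ) < H / (g * Real.log 2) := (ENNReal.ofReal_lt_ofReal_iff_of_nonneg b.2).1 h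
  -- If `g = 0` the quotient is `0` by convention and cannot exceed `b`.
  have hpos : 0 < (g : ℝ) * Real.log 2 := by
    rcases (mul_nonneg g.cast_nonneg (Real.log_pos one_lt_two).le :
      (0 : ℝ) ≤ g * Real.log 2).eq_or_lt with h2 | h2
    · rw [← h2, div_zero] at h1
      exact absurd h1 (not_lt.2 b.2)
    · exact h2
  exact ((lt_div_iff₀ hpos).1 h1).le

lemma tendsto_ofReal_exp_neg_mul {c : ℝ} (hc : 0 < c) :
    Tendsto (fun j : ℕ => ENNReal.ofReal (Real.exp (-(c * j)))) atTop (nhds 0) := by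
  rw [← ENNReal.ofReal_zero]
  refine ENNReal.tendsto_ofReal (Real.tendsto_exp_atBot.comp ?_)
  exact tendsto_neg_atTop_atBot.comp (tendsto_natCast_atTop_atTop.const_mul_atTop hc)

theorem hbDimMeasure_le_of_liminf_lt {q : ℕ → ℕ} (hq : IsSecondOstrogradsky q)
    {p : Fin 2 → ℕ → ℝ} (h0 : ∀ i k, 0 ≤ p i k) (h1 : ∀ k, p 0 k + p 1 k = 1)
    (hinf : {k | 0 < entropy p k}.Infinite)
    {M M' : Measure (ℕ → Fin 2)} [IsProbabilityMeasure M]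
    (hM : ∀ (n : ℕ) (w : Fin n → Fin 2),
      M (digitPrefix n ⁻¹' {w}) = ENNReal.ofReal (wordProb p w))
    (hM' : ∀ (n : ℕ) (w : Fin n → Fin 2),
      M' (digitPrefix n ⁻¹' {w}) = ENNReal.ofReal (wordProb (uniformProb p) w))
    {a : ℝ≥0}
    (ha : liminf (fun n : ℕ => ENNReal.ofReal
      (entropySum p n / ((positiveCount p n : ℝ) * Real.log 2))) atTop < a) :
    hbDimMeasure (M.map (digitSum q)) (M'.map (digitSum q)) ≤ a := by
  have hemb := measurableEmbedding_digitSum hq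
  obtain ⟨b, hb, hba⟩ := ENNReal.lt_iff_exists_nnreal_btwn.1 ha
  rw [ENNReal.coe_lt_coe] at hba
  -- The gap `b < r` feeds the large deviation estimate; the gap `r < a` makes the covering cost
  -- geometric.
  obtain ⟨r, hbr, hra⟩ := exists_between hba
  have ha0 : 0 < a := zero_le.trans_lt hra
  obtain ⟨c, hc0, hc⟩ := sum_wordProb_of_gt_le h0 h1 (NNReal.coe_lt_coe.2 hbr)
  have hfreq : ∀ j : ℕ, ∃ n, j ≤ positiveCount p n ∧
      entropySum p n ≤ b * (positiveCount p n * Real.log 2) := by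
    intro j
    obtain ⟨n, hn1, hn2⟩ := ((frequently_lt_of_liminf_lt (by isBoundedDefault) hb).and_eventually
      ((tendsto_positiveCount hinf).eventually_ge_atTop (j + 1))).exists
    exact ⟨n, by omega, le_mul_of_ofReal_div_lt (by omega) hn1⟩
  choose n hn hH using hfreq
  let G : ∀ j, Finset (Fin (n j) → Fin 2) := fun j =>
    Finset.univ.filter fun w => (2 : ℝ) ^ (-((r : ℝ) * positiveCount p (n j))) ≤ wordProb p w
  let B : ℕ → Set (ℕ → Fin 2) := fun j => digitPrefix (n j) ⁻¹' G j
  have hBm : ∀ j, MeasurableSet (B j) := fun j =>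
    measurable_digitPrefix _ (G j).measurableSet
  -- The limsup of the `B j`. It has full measure because each tail union misses at most the mass of
  -- `(B j)ᶜ`, which tends to `0`.
  let F : Set (ℕ → Fin 2) := ⋂ i : ℕ, ⋃ j : ℕ, B (j + i)
  have hFm : MeasurableSet F := MeasurableSet.iInter fun i => MeasurableSet.iUnion fun j => hBm _
  have hBc : ∀ j, M (B j)ᶜ ≤ ENNReal.ofReal (Real.exp (-(c * j))) := by
    intro j
    have heq : (B j)ᶜ = digitPrefix (n j) ⁻¹' (Finset.univ.filter fun w : Fin (n j) → Fin 2 =>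
        wordProb p w < (2 : ℝ) ^ (-((r : ℝ) * positiveCount p (n j))) : Finset _) := by
      ext d
      simp [B, G]
    rw [heq]
    refine (measure_digitPrefix_mem_le h0 (hM _) _).trans (ENNReal.ofReal_le_ofReal ?_)
    refine (hc (n j) (hH j)).trans (Real.exp_le_exp.2 (neg_le_neg ?_))
    gcongr
    exact hn j
  have hFc : M Fᶜ = 0 := by
    simp only [F, Set.compl_iInter, Set.compl_iUnion]
    refine measure_iUnion_null fun i => le_antisymm ?_ zero_le
    refine ge_of_tendsto ((tendsto_ofReal_exp_neg_mul hc0).comp (tendsto_add_atTop_nat i))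
      (Eventually.of_forall fun j => ?_)
    exact (measure_mono (Set.iInter_subset _ j)).trans (hBc (j + i))
  choose J hJI hJ using fun (m : ℕ) (w : Fin m → Fin 2) => exists_hull hq w
  have hνJ : ∀ (m : ℕ) (w : Fin m → Fin 2),
      M'.map (digitSum q) (J m w) ≤ 2⁻¹ ^ positiveCount p m := by
    intro m w
    rw [hemb.map_apply, hJ, hM', ← ofReal_half_pow]
    exact ENNReal.ofReal_le_ofReal (wordProb_uniformProb_le h0 h1 w)
  -- the cost of covering the good words of level `j`
  set s : ℝ := (1 / 2) ^ ((a : ℝ) - r) with hs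
  have hs0 : 0 < s := by positivity
  have hs1 : s < 1 := Real.rpow_lt_one (by norm_num) (by norm_num)
    (sub_pos.2 (NNReal.coe_lt_coe.2 hra))
  have hcost : ∀ j, ∑ w ∈ G j, M'.map (digitSum q) (J (n j) w) ^ (a : ℝ)
      ≤ ENNReal.ofReal s ^ j := by
    intro j
    set g := positiveCount p (n j) with hg
    have hcard := card_wordProb_ge_le h0 h1 (n j) (r := (2 : ℝ) ^ (-((r : ℝ) * g)))
    calc ∑ w ∈ G j, M'.map (digitSum q) (J (n j) w) ^ (a : ℝ)
        ≤ ∑ w ∈ G j, ENNReal.ofReal (((1 / 2) ^ g) ^ (a : ℝ)) := by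
          refine Finset.sum_le_sum fun w _ => ?_
          rw [← ENNReal.ofReal_rpow_of_nonneg (by positivity) a.coe_nonneg, ofReal_half_pow]
          exact ENNReal.rpow_le_rpow (hνJ _ w) a.coe_nonneg
      _ = ENNReal.ofReal ((G j).card * ((1 / 2) ^ g) ^ (a : ℝ)) := by
          rw [Finset.sum_const, nsmul_eq_mul, ENNReal.ofReal_mul (Nat.cast_nonneg _),
            ENNReal.ofReal_natCast]
      _ ≤ ENNReal.ofReal (s ^ g) := by
          refine ENNReal.ofReal_le_ofReal ?_
          -- Splitting off `2 ^ (-r g)` cancels the number of good words.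
          have h2 : ((1 / 2 : ℝ) ^ g) ^ (a : ℝ) = (2 : ℝ) ^ (-((r : ℝ) * g)) * s ^ g := by
            rw [hs, ← Real.rpow_natCast, ← Real.rpow_natCast, ← Real.rpow_mul (by norm_num),
              ← Real.rpow_mul (by norm_num), one_div, Real.inv_rpow two_pos.le,
              Real.inv_rpow two_pos.le, ← Real.rpow_neg two_pos.le, ← Real.rpow_neg two_pos.le,
              ← Real.rpow_add two_pos]
            congr 1
            ring
          rw [h2, ← mul_assoc]
          exact mul_le_of_le_one_left (by positivity) hcard
      _ ≤ ENNReal.ofReal (s ^ j) :=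
          ENNReal.ofReal_le_ofReal (pow_le_pow_of_le_one hs0.le hs1.le (hn j))
      _ = ENNReal.ofReal s ^ j := ENNReal.ofReal_pow hs0.le j
  have hzero : hbMeasure a (digitSum q '' F) (M'.map (digitSum q)) closedIntervals = 0 := by
    refine le_antisymm (iSup₂_le fun ε hε => ?_) zero_le
    have hsum : ∑' j : ℕ, ENNReal.ofReal s ^ j ≠ ∞ := by
      rw [ENNReal.tsum_geometric]
      refine ENNReal.inv_ne_top.2 (tsub_pos_of_lt ?_).ne'
      rwa [ENNReal.ofReal_lt_one]
    refine ge_of_tendsto (ENNReal.tendsto_sum_nat_add _ hsum) ?_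
    obtain ⟨i₀, hi₀⟩ := ENNReal.exists_inv_two_pow_lt hε.ne'
    filter_upwards [eventually_ge_atTop i₀] with i hi
    -- All hulls of good words from stage `i` on. Distinct words giving the same interval would only
    -- lower the sum over the range.
    let f : (Σ k : ℕ, {w // w ∈ G (k + i)}) → Set ℝ := fun x => J _ x.2.1
    refine iInf_le_of_le (Set.range f) (iInf_le_of_le ?_ (iInf_le_of_le (Set.countable_range f)
      (iInf_le_of_le ?_ (iInf_le_of_le ?_ ?_))))
    · rintro _ ⟨x, rfl⟩
      exact hJI _ _
    · rintro _ ⟨d, hd, rfl⟩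
      obtain ⟨k, hk⟩ := Set.mem_iUnion.1 (Set.mem_iInter.1 hd i)
      refine ⟨_, ⟨⟨k, digitPrefix _ d, hk⟩, rfl⟩, ?_⟩
      change d ∈ digitSum q ⁻¹' J _ (digitPrefix _ d)
      rw [hJ]
      rfl
    · rintro _ ⟨x, rfl⟩
      refine (hνJ _ _).trans (le_trans ?_ hi₀.le)
      refine pow_le_pow_right_of_le_one' (by simp) ?_
      have := hn (x.1 + i)
      omega
    · calc ∑' I : Set.range f, M'.map (digitSum q) (I : Set ℝ) ^ (a : ℝ)
          ≤ ∑' x, M'.map (digitSum q) (f x) ^ (a : ℝ) :=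
            ENNReal.tsum_le_tsum_comp_of_surjective Set.rangeFactorization_surjective
              fun I : Set.range f => M'.map (digitSum q) (I : Set ℝ) ^ (a : ℝ)
        _ = ∑' k : ℕ, ∑' w : {w // w ∈ G (k + i)},
              M'.map (digitSum q) (J _ w.1) ^ (a : ℝ) := ENNReal.tsum_sigma' _
        _ ≤ ∑' k : ℕ, ENNReal.ofReal s ^ (k + i) := by
            refine ENNReal.tsum_le_tsum fun k => ?_
            rw [(G (k + i)).tsum_subtype fun w => M'.map (digitSum q) (J _ w) ^ (a : ℝ)]
            exact hcost (k + i)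
  have hfull : M.map (digitSum q) (digitSum q '' F) = 1 := by
    rw [hemb.map_apply, Set.preimage_image_eq _ hemb.injective]
    exact (prob_compl_eq_zero_iff hFm).1 hFc
  exact iInf_le_of_le _ (iInf_le_of_le (hemb.measurableSet_image.2 hFm) (iInf_le_of_le hfull
    (iInf_le_of_le a (iInf_le_of_le ha0 (iInf_le_of_le hzero le_rfl)))))

/-! ### The lower bound -/

/-- An interval that meets three cylinders contains the middle one. -/
lemma le_measure_of_meets_three {q : ℕ → ℕ} (hq : IsSecondOstrogradsky q)
    {p : Fin 2 → ℕ → ℝ} (h0 : ∀ i k, 0 ≤ p i k) (h1 : ∀ k, p 0 k + p 1 k = 1)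
    {M' : Measure (ℕ → Fin 2)} {n : ℕ}
    (hM' : ∀ w : Fin n → Fin 2,
      M' (digitPrefix n ⁻¹' {w}) = ENNReal.ofReal (wordProb (uniformProb p) w))
    {I : Set ℝ} (hI : I.OrdConnected) {d e f : ℕ → Fin 2}
    (hde : digitPrefix n d ≠ digitPrefix n e) (hef : digitPrefix n e ≠ digitPrefix n f)
    (hlt : digitSum q d < digitSum q e) (hlt' : digitSum q e < digitSum q f)
    (hd : digitSum q d ∈ I) (hf : digitSum q f ∈ I) (he : wordProb p (digitPrefix n e) ≠ 0) :
    2⁻¹ ^ positiveCount p n ≤ M' (digitSum q ⁻¹' I) := by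
  rw [← ofReal_half_pow, ← wordProb_uniformProb_eq h0 h1 he, ← hM']
  refine measure_mono fun x hx => hI.out hd hf ⟨?_, ?_⟩
  · exact (digitSum_lt_of_digitPrefix hq hde rfl hx hlt).le
  · exact (digitSum_lt_of_digitPrefix hq hef hx rfl hlt').le

/-- An interval of small measure meets at most two cylinders of positive probability. -/
lemma measure_inter_preimage_le {q : ℕ → ℕ} (hq : IsSecondOstrogradsky q)
    {p : Fin 2 → ℕ → ℝ} (h0 : ∀ i k, 0 ≤ p i k) (h1 : ∀ k, p 0 k + p 1 k = 1)
    {M M' : Measure (ℕ → Fin 2)} {n : ℕ}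
    (hM : ∀ w : Fin n → Fin 2, M (digitPrefix n ⁻¹' {w}) = ENNReal.ofReal (wordProb p w))
    (hM' : ∀ w : Fin n → Fin 2,
      M' (digitPrefix n ⁻¹' {w}) = ENNReal.ofReal (wordProb (uniformProb p) w))
    {I : Set ℝ} (hI : I.OrdConnected)
    (hsmall : M' (digitSum q ⁻¹' I) < 2⁻¹ ^ positiveCount p n)
    {A : Set (ℕ → Fin 2)} {b : ℝ} (hA : ∀ d ∈ A, wordProb p (digitPrefix n d) ≤ b) :
    M (A ∩ digitSum q ⁻¹' I) ≤ 2 * ENNReal.ofReal b := by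
  classical
  let V : Finset (Fin n → Fin 2) := Finset.univ.filter fun w =>
    ∃ d ∈ A ∩ digitSum q ⁻¹' I, digitPrefix n d = w
  -- Arbitrarily many null words may be met, but they carry no mass; only charged words have the
  -- uniform mass `2⁻¹ ^ g` that limits their number.
  let W : Finset (Fin n → Fin 2) := V.filter fun w => wordProb p w ≠ 0
  have hsub : A ∩ digitSum q ⁻¹' I ⊆ digitPrefix n ⁻¹' V := fun d hd =>
    Finset.mem_coe.2 (Finset.mem_filter.2 ⟨Finset.mem_univ _, d, hd, rfl⟩)
  have hcard : W.card ≤ 2 := by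
    by_contra! hcon
    obtain ⟨u, hu, v, hv, w, hw, huv, huw, hvw⟩ := Finset.two_lt_card.1 hcon
    simp only [W, V, Finset.mem_filter, Finset.mem_univ, true_and] at hu hv hw
    obtain ⟨⟨d, ⟨-, hd⟩, rfl⟩, hd0⟩ := hu
    obtain ⟨⟨e, ⟨-, he⟩, rfl⟩, he0⟩ := hv
    obtain ⟨⟨f, ⟨-, hf⟩, rfl⟩, hf0⟩ := hw
    have hne : ∀ {x y : ℕ → Fin 2}, digitPrefix n x ≠ digitPrefix n y →
        digitSum q x < digitSum q y ∨ digitSum q y < digitSum q x := fun h =>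
      lt_or_gt_of_ne fun h' => h (by rw [digitSum_injective hq h'])
    refine absurd hsmall (not_lt.2 ?_)
    -- Each consistent ordering of the three sums singles out a middle cylinder; the two cyclic
    -- patterns are contradictory.
    rcases hne huv with a | a <;> rcases hne huw with b | b <;> rcases hne hvw with c | c
    · exact le_measure_of_meets_three hq h0 h1 hM' hI huv hvw a c hd hf he0
    · exact le_measure_of_meets_three hq h0 h1 hM' hI huw hvw.symm b c hd he hf0
    · exact absurd (a.trans c) b.not_gt
    · exact le_measure_of_meets_three hq h0 h1 hM' hI huw.symm huv b a hf he hd0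
    · exact le_measure_of_meets_three hq h0 h1 hM' hI huv.symm huw a b he hf hd0
    · exact absurd (a.trans b) c.not_gt
    · exact le_measure_of_meets_three hq h0 h1 hM' hI hvw huw.symm c b he hd hf0
    · exact le_measure_of_meets_three hq h0 h1 hM' hI hvw.symm huv.symm c a hf hd he0
  calc M (A ∩ digitSum q ⁻¹' I) ≤ M (digitPrefix n ⁻¹' V) := measure_mono hsub
    _ ≤ ENNReal.ofReal (∑ w ∈ V, wordProb p w) := measure_digitPrefix_mem_le h0 hM V
    _ = ENNReal.ofReal (∑ w ∈ W, wordProb p w) := by rw [Finset.sum_filter_ne_zero]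
    _ ≤ ENNReal.ofReal (2 * max b 0) := by
        refine ENNReal.ofReal_le_ofReal ?_
        calc ∑ w ∈ W, wordProb p w ≤ W.card • max b 0 := by
              refine Finset.sum_le_card_nsmul _ _ _ fun w hw => ?_
              obtain ⟨d, hd, rfl⟩ := (Finset.mem_filter.1 (Finset.mem_filter.1 hw).1).2
              exact (hA d hd.1).trans (le_max_left _ _)
          _ ≤ 2 * max b 0 := by
              rw [nsmul_eq_mul]
              gcongr
              exact_mod_cast hcard
    _ = 2 * ENNReal.ofReal b := by
        rw [ENNReal.ofReal_mul two_pos.le, ENNReal.ofReal_ofNat]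
        congr 1
        rcases le_total b 0 with h | h
        · rw [max_eq_right h, ENNReal.ofReal_zero, ENNReal.ofReal_of_nonpos h]
        · rw [max_eq_left h]

/-- From bounds at dyadic scales to a bound at all scales. -/
lemma le_mul_rpow_of_dyadic {x y : ℝ≥0∞} {N : ℕ} {a : ℝ} (ha : 0 < a) (hx : x ≤ 2⁻¹ ^ (N + 1))
    (h : ∀ m ≥ N, x < 2⁻¹ ^ m → y ≤ 2 * (2⁻¹ ^ m) ^ a) : y ≤ 2 * 2 ^ a * x ^ a := by
  have hhalf : (2⁻¹ : ℝ≥0∞) < 1 := ENNReal.inv_lt_one.2 ENNReal.one_lt_two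
  rcases eq_or_ne x 0 with rfl | hx0
  -- For `x = 0` all scales apply, and the bound tends to `0`.
  · rw [ENNReal.zero_rpow_of_pos ha, mul_zero]
    have hlim : Tendsto (fun m : ℕ => 2 * ((2⁻¹ : ℝ≥0∞) ^ m) ^ a) atTop (nhds (2 * 0 ^ a)) :=
      ENNReal.Tendsto.const_mul ((ENNReal.continuous_rpow_const.tendsto 0).comp
        (ENNReal.tendsto_pow_atTop_nhds_zero_of_lt_one hhalf)) (Or.inr (by simp))
    rw [ENNReal.zero_rpow_of_pos ha, mul_zero] at hlim
    refine ge_of_tendsto hlim ?_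
    filter_upwards [eventually_ge_atTop N] with m hm
    exact h m hm (ENNReal.pow_pos (by simp) m)
  · classical
    have hex : ∃ n : ℕ, (2⁻¹ : ℝ≥0∞) ^ n ≤ x :=
      (ENNReal.exists_inv_two_pow_lt hx0).imp fun _ h => h.le
    have hN : N + 1 ≤ Nat.find hex := by
      by_contra! hcon
      have h2 : (2⁻¹ : ℝ≥0∞) ^ (N + 1) < 2⁻¹ ^ Nat.find hex := by
        rw [← ofReal_half_pow, ← ofReal_half_pow, ENNReal.ofReal_lt_ofReal_iff (by positivity)]
        exact pow_lt_pow_right_of_lt_one₀ (by norm_num) (by norm_num) hcon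
      exact absurd (h2.trans_le (Nat.find_spec hex)) (not_lt.2 hx)
    -- The scale is fixed by `2 ^ (-(m + 1)) ≤ x < 2 ^ (-m)`; the loss of one factor `2` produces
    -- the constant `2 ^ a`.
    obtain ⟨m, hm⟩ := Nat.exists_eq_add_of_le' (Nat.one_le_of_lt hN)
    have hmN : N ≤ m := by omega
    have hxm : x < 2⁻¹ ^ m := not_le.1 (Nat.find_min hex (m := m) (by omega))
    have hmx : (2⁻¹ : ℝ≥0∞) ^ m ≤ 2 * x := by
      have h3 := Nat.find_spec hex
      rw [hm, pow_succ] at h3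
      calc (2⁻¹ : ℝ≥0∞) ^ m = 2 * (2⁻¹ ^ m * 2⁻¹) := by
            rw [mul_left_comm, ENNReal.mul_inv_cancel two_ne_zero ENNReal.ofNat_ne_top, mul_one]
        _ ≤ 2 * x := by gcongr
    calc y ≤ 2 * (2⁻¹ ^ m) ^ a := h m hmN hxm
      _ ≤ 2 * (2 * x) ^ a := by gcongr
      _ = 2 * 2 ^ a * x ^ a := by rw [ENNReal.mul_rpow_of_nonneg _ _ ha.le, mul_assoc]

theorem hbMeasure_ne_zero_of_lt_liminf {q : ℕ → ℕ} (hq : IsSecondOstrogradsky q)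
    {p : Fin 2 → ℕ → ℝ} (h0 : ∀ i k, 0 ≤ p i k) (h1 : ∀ k, p 0 k + p 1 k = 1)
    (hinf : {k | 0 < entropy p k}.Infinite)
    {M M' : Measure (ℕ → Fin 2)} [IsProbabilityMeasure M]
    (hM : ∀ (n : ℕ) (w : Fin n → Fin 2),
      M (digitPrefix n ⁻¹' {w}) = ENNReal.ofReal (wordProb p w))
    (hM' : ∀ (n : ℕ) (w : Fin n → Fin 2),
      M' (digitPrefix n ⁻¹' {w}) = ENNReal.ofReal (wordProb (uniformProb p) w))
    {a : ℝ≥0} (ha0 : 0 < a)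
    (ha : (a : ℝ≥0∞) < liminf (fun n : ℕ => ENNReal.ofReal
      (entropySum p n / ((positiveCount p n : ℝ) * Real.log 2))) atTop)
    {E : Set ℝ} (hE : M.map (digitSum q) E = 1) :
    hbMeasure a E (M'.map (digitSum q)) closedIntervals ≠ 0 := by
  have hemb := measurableEmbedding_digitSum hq
  obtain ⟨b, hab, hb⟩ := ENNReal.lt_iff_exists_nnreal_btwn.1 ha
  rw [ENNReal.coe_lt_coe] at hab
  obtain ⟨c, hc0, hc⟩ := sum_wordProb_of_lt_le h0 h1 (NNReal.coe_lt_coe.2 hab)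
  obtain ⟨n₀, hn₀⟩ := eventually_atTop.1 (eventually_lt_of_lt_liminf hb)
  -- One level per value `m` of the count makes the exceptional masses `exp (-c m)` summable; over
  -- all levels the count could stay constant arbitrarily long.
  choose n hn using exists_positiveCount_eq hinf
  let G : ∀ m, Finset (Fin (n m) → Fin 2) := fun m =>
    Finset.univ.filter fun w => (2 : ℝ) ^ (-((a : ℝ) * positiveCount p (n m))) < wordProb p w
  have hG : ∀ m ≥ n₀, M (digitPrefix (n m) ⁻¹' G m) ≤ ENNReal.ofReal (Real.exp (-(c * m))) := by
    intro m hm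
    have hnm : n₀ ≤ n m := hm.trans ((hn m).symm.le.trans (positiveCount_le p (n m)))
    refine (measure_digitPrefix_mem_le h0 (hM _) _).trans (ENNReal.ofReal_le_ofReal ?_)
    refine (hc (n m) (mul_le_of_lt_ofReal_div (hn₀ _ hnm))).trans_eq ?_
    rw [hn]
  have hsum : ∑' m : ℕ, ENNReal.ofReal (Real.exp (-(c * m))) ≠ ∞ := by
    have heq : ∀ m : ℕ, ENNReal.ofReal (Real.exp (-(c * m))) =
        ENNReal.ofReal (Real.exp (-c)) ^ m := fun m => by
      rw [← ENNReal.ofReal_pow (Real.exp_pos _).le, ← Real.exp_nat_mul]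
      congr 2
      ring
    simp only [heq]
    rw [ENNReal.tsum_geometric]
    refine ENNReal.inv_ne_top.2 (tsub_pos_of_lt ?_).ne'
    rw [ENNReal.ofReal_lt_one, Real.exp_lt_one_iff]
    linarith
  obtain ⟨N, hN1, hN⟩ := (((ENNReal.tendsto_sum_nat_add _ hsum).eventually_lt_const
    (zero_lt_one (α := ℝ≥0∞))).and (eventually_ge_atTop n₀)).exists
  let B : Set (ℕ → Fin 2) := ⋃ k : ℕ, digitPrefix (n (k + N)) ⁻¹' G (k + N)
  have hB : M B < 1 := by
    refine lt_of_le_of_lt ((measure_iUnion_le _).trans (ENNReal.tsum_le_tsum fun k => ?_)) hN1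
    exact hG (k + N) (by omega)
  let A : Set (ℕ → Fin 2) := digitSum q ⁻¹' E \ B
  have hA : 0 < M A := by
    refine lt_of_lt_of_le ?_ le_measure_sdiff
    rw [← hemb.map_apply, hE]
    exact tsub_pos_of_lt hB
  have hAw : ∀ m ≥ N, ∀ d ∈ A, wordProb p (digitPrefix (n m) d) ≤ (2 : ℝ) ^ (-((a : ℝ) * m)) := by
    intro m hm d hd
    by_contra! hcon
    refine hd.2 (Set.mem_iUnion.2 ⟨m - N, ?_⟩)
    rw [Nat.sub_add_cancel hm]
    simpa [G, hn] using hcon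
  -- The local estimate of the mass distribution principle; summed over a covering, it bounds the
  -- cost below by a multiple of `M A`.
  have hkey : ∀ I ∈ closedIntervals, M'.map (digitSum q) I ≤ 2⁻¹ ^ (N + 1) →
      M (A ∩ digitSum q ⁻¹' I) ≤ 2 * 2 ^ (a : ℝ) * M'.map (digitSum q) I ^ (a : ℝ) := by
    rintro _ ⟨u, v, -, rfl⟩ hI
    refine le_mul_rpow_of_dyadic (NNReal.coe_pos.2 ha0) hI fun m hm hlt => ?_
    rw [hemb.map_apply, ← hn m] at hlt
    refine (measure_inter_preimage_le hq h0 h1 (hM _) (hM' _) Set.ordConnected_Icc hlt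
      (hAw m hm)).trans_eq ?_
    rw [← ofReal_half_pow, ENNReal.ofReal_rpow_of_nonneg (by positivity) a.coe_nonneg,
      ← Real.rpow_natCast, ← Real.rpow_mul (by norm_num), one_div, Real.inv_rpow two_pos.le,
      ← Real.rpow_neg two_pos.le, mul_comm (m : ℝ)]
  have hpos : 0 < M A / (2 * 2 ^ (a : ℝ)) :=
    ENNReal.div_pos hA.ne' (ENNReal.mul_ne_top (by simp) (by simp))
  refine (hpos.trans_le ?_).ne'
  refine le_iSup₂_of_le (2⁻¹ ^ (N + 1)) (ENNReal.pow_pos (by simp) _) ?_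
  refine le_iInf fun 𝒞 => le_iInf fun h𝒞 => le_iInf fun hcount => le_iInf fun hcov =>
    le_iInf fun hsmall => ENNReal.div_le_of_le_mul' ?_
  calc M A ≤ M (⋃ I ∈ 𝒞, A ∩ digitSum q ⁻¹' I) := by
        refine measure_mono fun d hd => ?_
        obtain ⟨I, hI, hdI⟩ := hcov hd.1
        exact Set.mem_biUnion hI ⟨hd, hdI⟩
    _ ≤ ∑' I : 𝒞, M (A ∩ digitSum q ⁻¹' I) := measure_biUnion_le M hcount _
    _ ≤ ∑' I : 𝒞, 2 * 2 ^ (a : ℝ) * M'.map (digitSum q) I ^ (a : ℝ) :=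
        ENNReal.tsum_le_tsum fun I => hkey I (h𝒞 I.2) (hsmall I I.2)
    _ = _ := ENNReal.tsum_mul_left

end Ostrogradsky

theorem mainTheorem3
    (q : ℕ → ℕ) (hq : Ostrogradsky.IsSecondOstrogradsky q)
    (p : Fin 2 → ℕ → ℝ)
    {Ω : Type*} [MeasurableSpace Ω] (P : Measure Ω) [IsProbabilityMeasure P]
    (ξ : ℕ → Ω → ℝ) (hξ : Ostrogradsky.IsBernoulliSequence P ξ p)
    {Ω' : Type*} [MeasurableSpace Ω'] (P' : Measure Ω') [IsProbabilityMeasure P']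
    (ξ' : ℕ → Ω' → ℝ)
    (hξ' : Ostrogradsky.IsBernoulliSequence P' ξ' (Ostrogradsky.uniformProb p))
    (hinf : {k : ℕ | max (p 0 k) (p 1 k) < 1}.Infinite) :
    Ostrogradsky.hbDimMeasure (Ostrogradsky.seriesLaw P ξ q) (Ostrogradsky.seriesLaw P' ξ' q) =
      liminf (fun n : ℕ => ENNReal.ofReal
        (Ostrogradsky.entropySum p n / ((Ostrogradsky.positiveCount p n : ℝ) * Real.log 2)))
        atTop := by
  obtain ⟨M, hMprob, hMlaw, hM⟩ := hξ.exists_digit_law hq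
  obtain ⟨M', -, hMlaw', hM'⟩ := hξ'.exists_digit_law hq
  have hinf' : {k | 0 < Ostrogradsky.entropy p k}.Infinite := by
    refine hinf.mono fun k hk => ?_
    have h : p 0 k < 1 ∧ p 1 k < 1 := max_lt_iff.1 hk
    have hsum := hξ.sum_eq_one k
    refine (Ostrogradsky.entropy_pos_iff (fun i => hξ.nonneg i k) hsum).2 ⟨?_, ?_⟩
    · intro h0
      linarith [h.2]
    · intro h0
      linarith [h.1]
  rw [hMlaw, hMlaw']
  apply le_antisymm
  · refine le_of_forall_gt fun y hy => ?_
    obtain ⟨a, ha, hay⟩ := ENNReal.lt_iff_exists_nnreal_btwn.1 hy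
    exact (Ostrogradsky.hbDimMeasure_le_of_liminf_lt hq hξ.nonneg hξ.sum_eq_one hinf' hM hM'
      ha).trans_lt hay
  · refine le_iInf fun E => le_iInf fun _ => le_iInf fun hE => le_iInf fun a =>
      le_iInf fun ha0 => le_iInf fun hzero => ?_
    by_contra! hlt
    exact Ostrogradsky.hbMeasure_ne_zero_of_lt_liminf hq hξ.nonneg hξ.sum_eq_one hinf' hM hM'
      ha0 hlt hE hzero
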